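/- Let $K$ be an algebraically closed field (of any characteristic) and $\mathbb N=\{0,1,2,\dots\}$. A sequence $a:\mathbb N\to K$ is a *dynamical sequence* over $K$ if there are a quasi-projective variety $X$ over $K$, rational maps $\varphi:X\dashrightarrow X$ and $f:X\dashrightarrow\mathbb A^1$ over $K$, and a point $x_0\in X(K)$ such that the forward orbit $x_{n+1}=\varphi(x_n)$ is defined for all $n$ (that is, no $x_n$ lies in the indeterminacy locus of $\varphi$), $f$ is defined at every $x_n$, and $a(n)=f(x_n)$ for all $n\ge 0$. Here $X$ may even be taken irreducible. For a class $R$ of sequences $\mathbb N\to K$, call $a$ *$R$-finite* if there are $r\ge 0$ and $c_0,\dots,c_r\in R$ such that $c_r(n)\ne 0$ for all but finitely many $n$ and $c_0(n)a(n)+\cdots+c_r(n)a(n+r)=0$ for all $n\ge 0$. The $D^1$-finite (or $D$-finite) sequences are the $R$-finite sequences with $R$ the class of sequences $n\mapsto p(n)$, $p\in K[x]$; the $C^1$-finite sequences are those with $R$ the class of constant sequences; for $m\ge 1$, the $D^{m+1}$-finite (resp. $C^{m+1}$-finite) sequences are the $R$-finite sequences with $R$ the class of $D^m$-finite (resp.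 $C^m$-finite) sequences. **Theorem.** The following are all dynamical sequences over $K$: 1. every $D$-finite sequence and, more generally, every $D^m$-finite and every $C^m$-finite sequence, for every $m\ge 1$; 2. every Somos sequence with finitely many zero terms, i.e. every $a:\mathbb N\to K$ with $a(n)=0$ for only finitely many $n$ such that for some $k$ and all $n\ge k$, $$a(n)a(n-k)=\sum_{i=1}^{\lfloor k/2\rfloor}a(n-i)a(n-k+i);$$ 3. every elliptic divisibility sequence with finitely many zero terms; more generally, every $W:\mathbb N\to K$ with $W_n=0$ for only finitely many $n$ such that $W_1\neq 0$ and, for all $n>2$, $$W_{n+2}W_{n-2}W_1^2=W_{n+1}W_{n-1}W_2^2-W_3W_1W_n^2;$$ 4. every sequence $n\mapsto f(P(n))$, where $f:\mathbb N\to K$ satisfies a linear recurrence with constant coefficients in $K$ and $P\in\mathbb Q[x]$ satisfies $P(\mathbb N)\subseteq\mathbb N$; 5. every sequence $n\mapsto f(d^n)$, where $f:\mathbb N\to K$ satisfies a linear recurrence with constant coefficients in $K$ and $d\ge 0$ is an integer (with $0^0=1$). -/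

import Mathlib

open CategoryTheory AlgebraicGeometry

universe u

namespace DynSeq

/-! ### Varieties, rational maps, points -/

attribute [local instance] MvPolynomial.gradedAlgebra

/-- Projective `N`-space over `K`, as `Proj K[x₀, …, x_N]` with the grading by total degree. -/
noncomputable def ProjSpace (K : Type u) [Field K] (N : ℕ) : Scheme.{u} :=
  Proj (MvPolynomial.homogeneousSubmodule (Fin (N + 1)) K)

/-- The structure morphism of projective `N`-space over `K`. -/
noncomputable def ProjSpace.toBase (K : Type u) [Field K] (N : ℕ) :
    ProjSpace K N ⟶ Spec (.of K) :=
  Proj.toSpecZero (MvPolynomial.homogeneousSubmodule (Fin (N + 1)) K) ≫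
    Spec.map (CommRingCat.ofHom
      (algebraMap K (MvPolynomial.homogeneousSubmodule (Fin (N + 1)) K 0)))

/-- A quasi-projective variety over the (algebraically closed) field `K`: an integral `K`-scheme
that admits an immersion over `K` (an isomorphism onto a locally closed subscheme) into some
projective space over `K`. -/
structure IsQuasiProjectiveVariety (K : Type u) [Field K] (X : Scheme.{u})
    [X.Over (Spec (.of K))] : Prop where
  isIntegral : IsIntegral X
  exists_immersion : ∃ (N : ℕ) (i : X ⟶ ProjSpace K N),
    IsImmersion i ∧ i ≫ ProjSpace.toBase K N = X ↘ Spec (.of K)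

/-- The rational map `g : X ⤏ Y` is defined at the `T`-point `p` of `X` and takes the value `q`
there: some representative `h` of `g` is defined on an open set through which `p` factors, and it
sends `p` to `q`. For `X` reduced and `Y` separated this says that `p` factors through the domain
of definition `g.domain` of `g`, i.e. avoids the indeterminacy locus, and that `g(p) = q`. -/
def MapsPoint {T X Y : Scheme.{u}} (g : X ⤏ Y) (p : T ⟶ X) (q : T ⟶ Y) : Prop :=
  ∃ h : X.PartialMap Y, h.toRationalMap = g ∧
    ∃ p' : T ⟶ h.domain.toScheme, p' ≫ h.domain.ι = p ∧ p' ≫ h.hom = q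

/-- The affine line over `K`. -/
noncomputable abbrev AffineLine (K : Type u) [Field K] : Scheme.{u} :=
  𝔸(PUnit.{u + 1}; Spec (.of K))

/-- The `K`-point of the affine line with coordinate `c`. -/
noncomputable def linePoint {K : Type u} [Field K] (c : K) : Spec (.of K) ⟶ AffineLine K :=
  AffineSpace.homOfVector (𝟙 _) (fun _ => (Scheme.ΓSpecIso (.of K)).inv.hom c)

/-! ### Dynamical sequences -/

/-- `a` is a dynamical sequence over `K`: there are a quasi-projective variety `X` over `K`,
rational maps `φ : X ⤏ X` and `f : X ⤏ 𝔸¹` over `K`, and a `K`-point `x 0` of `X` with a forward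
orbit `x 0, x 1, …` such that, for all `n`, `φ` is defined at `x n` with `φ (x n) = x (n + 1)` and
`f` is defined at `x n` with `f (x n) = a n`. -/
def IsDynamicalSequence {K : Type u} [Field K] (a : ℕ → K) : Prop :=
  ∃ (X : Scheme.{u}) (_ : X.Over (Spec (.of K))) (φ : X ⤏ X) (f : X ⤏ AffineLine K)
    (x : ℕ → (Spec (.of K) ⟶ X)),
    IsQuasiProjectiveVariety K X ∧
    φ.IsOver (Spec (.of K)) ∧
    f.IsOver (Spec (.of K)) ∧
    x 0 ≫ X ↘ Spec (.of K) = 𝟙 _ ∧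
    (∀ n, MapsPoint φ (x n) (x (n + 1))) ∧
    (∀ n, MapsPoint f (x n) (linePoint (a n)))

/-! ### Classes of sequences -/

/-- `a` satisfies a linear recurrence `c₀(n) a(n) + ⋯ + c_r(n) a(n + r) = 0` for all `n`, with
coefficient sequences in the class `R` and with `c_r(n) ≠ 0` for all but finitely many `n`. -/
def IsFiniteOver {K : Type u} [Field K] (R : (ℕ → K) → Prop) (a : ℕ → K) : Prop :=
  ∃ (r : ℕ) (c : Fin (r + 1) → ℕ → K), (∀ i, R (c i)) ∧
    {n : ℕ | c (Fin.last r) n = 0}.Finite ∧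
    ∀ n, ∑ i, c i n * a (n + i) = 0

/-- `Dᵐ`-finite sequences: level `0` consists of the values of polynomials, level `1` of the
sequences with a linear recurrence with polynomial coefficients (`D`-finite, or holonomic,
sequences), and level `m + 1` of those with a linear recurrence with `Dᵐ`-finite coefficients.
In characteristic zero the condition in `IsFiniteOver` on the leading coefficient says for `m = 1`
that it is a nonzero polynomial. -/
def IsDnFinite {K : Type u} [Field K] : ℕ → (ℕ → K) → Prop
  | 0 => fun a => ∃ p : Polynomial K, ∀ n : ℕ, a n = p.eval (n : K)
  | m + 1 => IsFiniteOver (IsDnFinite m)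

/-- `Cᵐ`-finite sequences: level `0` consists of the constant sequences, level `1` of the
sequences with a linear recurrence with constant coefficients, and level `m + 1` of those with a
linear recurrence with `Cᵐ`-finite coefficients. -/
def IsCnFinite {K : Type u} [Field K] : ℕ → (ℕ → K) → Prop
  | 0 => fun a => ∃ c : K, ∀ n, a n = c
  | m + 1 => IsFiniteOver (IsCnFinite m)

/-- Somos sequences: for some `k`,
`a(n) a(n - k) = ∑_{i = 1}^{⌊k / 2⌋} a(n - i) a(n - k + i)` for all `n ≥ k`
(written with `n + k` in place of `n`). -/
def IsSomos {K : Type u} [Field K] (a : ℕ → K) : Prop :=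
  ∃ k : ℕ, ∀ n, a (n + k) * a n = ∑ i ∈ Finset.Icc 1 (k / 2), a (n + k - i) * a (n + i)

/-- The elliptic recurrence
`W(n + 2) W(n - 2) W(1)² = W(n + 1) W(n - 1) W(2)² - W(3) W(1) W(n)²` for all `n > 2`, with
`W(1) ≠ 0`. Every elliptic divisibility sequence that is not zero on the positive integers
satisfies this: `W(1)` divides all `W(n)` with `n ≥ 1`. -/
def IsEDS {K : Type u} [Field K] (W : ℕ → K) : Prop :=
  W 1 ≠ 0 ∧ ∀ n, 2 < n →
    W (n + 2) * W (n - 2) * W 1 ^ 2 = W (n + 1) * W (n - 1) * W 2 ^ 2 - W 3 * W 1 * W n ^ 2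

/-- `f` satisfies a linear recurrence with constant coefficients. -/
def IsLinearRecurrent {K : Type u} [Field K] (f : ℕ → K) : Prop :=
  ∃ E : LinearRecurrence K, E.IsSolution f

end DynSeq

/-!
All these sequences are rational functions of an orbit on an affine space. Call a sequence
*rationally recursive* if it is a rational function, with denominators that vanish at no index, of a
finite set of sequences whose shifts are again such rational functions of the set
(`IsRationallyRecursive`). The members of the finite set are then the coordinates of an orbit of a
rational self-map of affine space, and affine space is a quasi-projective variety, so the sequence
is dynamical (`IsRationallyRecursive.isDynamicalSequence`).

It remains to see that the sequences in question are rationally recursive. The class of rationally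
recursive sequences is closed under rational operations and under rational systems of recurrences
with coefficients in the class (`of_system`, `of_recurrence`), since finitely many systems can be
run side by side. It also contains a sequence as soon as it contains its shift (`of_shift`): an
additional coordinate with values `1, 0, 0, …` lets a rational map treat the first step separately.
So finitely many terms at which a leading coefficient vanishes, or by which one would have to
divide, do no harm. With the sequence of natural numbers as a starting point this gives the
`Dᵐ`-finite and `Cᵐ`-finite sequences by induction on `m`, and the Somos and elliptic recurrences,
which determine the next term rationally from the preceding ones.

A sequence `f` with a linear recurrence is a combination of the entries of `M ^ n` for a matrix `M`.
For `f (d ^ n)` the matrices `M ^ d ^ n` satisfy `X (n + 1) = X n ^ d`. For `f (p n)` with `p`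
polynomial, `M ^ p (n + 1) = M ^ p n * M ^ (p (n + 1) - p n)`, and the second factor is handled by
induction on the degree; the difference is nonnegative from some index on, so that `M` need not be
invertible. This argument does not depend on the characteristic.
-/

namespace DynSeq

/-! ### Sequences generated by rational operations -/

section RationalGeneration

variable {K : Type u} [Field K]

/-- `RatGen S a`: the sequence `a` arises from the sequences in `S` and the constants by finitely
many termwise additions, multiplications and inversions, where only a sequence without zero terms
may be inverted. So `a` is a fixed rational function of finitely many members of `S`, and no
denominator vanishes at any index. -/
inductive RatGen (S : Set (ℕ → K)) : (ℕ → K) → Prop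
  | of {a : ℕ → K} : a ∈ S → RatGen S a
  | const (c : K) : RatGen S (fun _ => c)
  | add {a b : ℕ → K} : RatGen S a → RatGen S b → RatGen S (fun n => a n + b n)
  | mul {a b : ℕ → K} : RatGen S a → RatGen S b → RatGen S (fun n => a n * b n)
  | inv {a : ℕ → K} : (∀ n, a n ≠ 0) → RatGen S a → RatGen S (fun n => (a n)⁻¹)

namespace RatGen

variable {S T : Set (ℕ → K)} {a b : ℕ → K}

theorem bind (ha : RatGen S a) (h : ∀ s ∈ S, RatGen T s) : RatGen T a := by
  induction ha with
  | of hs => exact h _ hs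
  | const c => exact const c
  | add _ _ iha ihb => exact iha.add ihb
  | mul _ _ iha ihb => exact iha.mul ihb
  | inv h0 _ ih => exact ih.inv h0

theorem mono (ha : RatGen S a) (h : S ⊆ T) : RatGen T a :=
  ha.bind fun _ hs => of (h hs)

theorem neg (ha : RatGen S a) : RatGen S (fun n => -a n) := by
  simpa using (const (-1)).mul ha

theorem sub (ha : RatGen S a) (hb : RatGen S b) : RatGen S (fun n => a n - b n) := by
  simpa [sub_eq_add_neg] using ha.add hb.neg

theorem div (ha : RatGen S a) (hb : RatGen S b) (h : ∀ n, b n ≠ 0) :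
    RatGen S (fun n => a n / b n) := by
  simpa [div_eq_mul_inv] using ha.mul (hb.inv h)

theorem sum {ι : Type*} (s : Finset ι) {f : ι → ℕ → K} (h : ∀ i ∈ s, RatGen S (f i)) :
    RatGen S (fun n => ∑ i ∈ s, f i n) := by
  classical
  induction s using Finset.induction_on with
  | empty => simpa using const (S := S) 0
  | insert i s hi ih =>
    simp only [Finset.sum_insert hi]
    exact (h i (Finset.mem_insert_self i s)).add
      (ih fun j hj => h j (Finset.mem_insert_of_mem hj))

theorem pow (ha : RatGen S a) (d : ℕ) : RatGen S (fun n => a n ^ d) := by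
  induction d with
  | zero => simpa using const (S := S) 1
  | succ d ih => simpa [pow_succ] using ih.mul ha

theorem polynomial_eval (ha : RatGen S a) (p : Polynomial K) :
    RatGen S (fun n => p.eval (a n)) := by
  simp only [Polynomial.eval_eq_sum, Polynomial.sum]
  exact sum _ fun i _ => (const _).mul (ha.pow i)

theorem comp (ha : RatGen S a) (g : ℕ → ℕ) (h : ∀ s ∈ S, RatGen T (fun n => s (g n))) :
    RatGen T (fun n => a (g n)) := by
  induction ha with
  | of hs => exact h _ hs
  | const c => exact const c
  | add _ _ iha ihb => exact iha.add ihb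
  | mul _ _ iha ihb => exact iha.mul ihb
  | inv h0 _ ih => exact ih.inv fun n => h0 (g n)

/-- The entries of a power of a matrix of sequences are generated by the entries of the matrix. -/
theorem matrix_pow {ι : Type*} [Fintype ι] [DecidableEq ι] {X : ℕ → Matrix ι ι K}
    (h : ∀ i j, RatGen S (fun n => X n i j)) (d : ℕ) (i j : ι) :
    RatGen S (fun n => (X n ^ d) i j) := by
  induction d generalizing i j with
  | zero => simpa using const (S := S) _
  | succ d ih =>
    simp only [pow_succ, Matrix.mul_apply]
    exact sum _ fun k _ => (ih i k).mul (h k j)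

/-- A sequence generated by a family `v` is the quotient of two polynomials in the family, the
denominator having no zero along the family. -/
theorem exists_eval_div_eval {ι : Type*} {v : ι → ℕ → K} (ha : RatGen (Set.range v) a) :
    ∃ p q : MvPolynomial ι K, ∀ n, MvPolynomial.eval (fun i => v i n) q ≠ 0 ∧
      a n = MvPolynomial.eval (fun i => v i n) p / MvPolynomial.eval (fun i => v i n) q := by
  induction ha with
  | of hs =>
    obtain ⟨i, rfl⟩ := hs
    exact ⟨MvPolynomial.X i, 1, fun n => by simp⟩
  | const c => exact ⟨MvPolynomial.C c, 1, fun n => by simp⟩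
  | add _ _ iha ihb =>
    obtain ⟨p, q, h⟩ := iha
    obtain ⟨p', q', h'⟩ := ihb
    refine ⟨p * q' + q * p', q * q', fun n => ?_⟩
    obtain ⟨h0, h1⟩ := h n
    obtain ⟨h0', h1'⟩ := h' n
    simp [h0, h0', h1, h1', div_add_div]
  | mul _ _ iha ihb =>
    obtain ⟨p, q, h⟩ := iha
    obtain ⟨p', q', h'⟩ := ihb
    refine ⟨p * p', q * q', fun n => ?_⟩
    obtain ⟨h0, h1⟩ := h n
    obtain ⟨h0', h1'⟩ := h' n
    simp [h0, h0', h1, h1', div_mul_div_comm]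
  | inv ha _ ih =>
    obtain ⟨p, q, h⟩ := ih
    refine ⟨q, p, fun n => ?_⟩
    obtain ⟨h0, h1⟩ := h n
    have hn := ha n
    rw [h1] at hn
    exact ⟨(div_ne_zero_iff.mp hn).1, by simp only [h1, inv_div]⟩

end RatGen

/-! ### Rationally recursive sequences -/

/-- A set of sequences is shift stable if the shift of each member is a rational function of the
members. For a finite set this says that the vector of its members moves along an orbit of a
rational self-map of affine space. -/
def IsShiftStable (S : Set (ℕ → K)) : Prop :=
  ∀ s ∈ S, RatGen S (fun n => s (n + 1))

theorem IsShiftStable.union {S T : Set (ℕ → K)} (hS : IsShiftStable S) (hT : IsShiftStable T) :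
    IsShiftStable (S ∪ T) := by
  rintro s (hs | hs)
  · exact (hS s hs).mono Set.subset_union_left
  · exact (hT s hs).mono Set.subset_union_right

theorem IsShiftStable.shift {S : Set (ℕ → K)} (hS : IsShiftStable S) {a : ℕ → K}
    (ha : RatGen S a) : RatGen S (fun n => a (n + 1)) :=
  ha.comp (· + 1) hS

/-- A sequence is rationally recursive if it is a rational function of the members of a finite
shift stable set, that is, of the coordinates of an orbit of a rational self-map of affine
space. -/
def IsRationallyRecursive (a : ℕ → K) : Prop :=
  ∃ S : Set (ℕ → K), S.Finite ∧ IsShiftStable S ∧ RatGen S a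

/-- A sequence generated by rationally recursive ones involves only finitely many of them, and
these come from a single finite shift stable set. -/
theorem RatGen.exists_finite {S : Set (ℕ → K)} {a : ℕ → K}
    (ha : RatGen (S ∪ {b | IsRationallyRecursive b}) a) :
    ∃ T : Set (ℕ → K), T.Finite ∧ IsShiftStable T ∧ RatGen (S ∪ T) a := by
  have pair : ∀ {a b : ℕ → K},
      (∃ T : Set (ℕ → K), T.Finite ∧ IsShiftStable T ∧ RatGen (S ∪ T) a) →
      (∃ T : Set (ℕ → K), T.Finite ∧ IsShiftStable T ∧ RatGen (S ∪ T) b) →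
      ∃ T : Set (ℕ → K), T.Finite ∧ IsShiftStable T ∧ RatGen (S ∪ T) a ∧ RatGen (S ∪ T) b := by
    rintro a b ⟨T, hf, hs, h⟩ ⟨T', hf', hs', h'⟩
    exact ⟨T ∪ T', hf.union hf', hs.union hs',
      h.mono (Set.union_subset_union_right _ Set.subset_union_left),
      h'.mono (Set.union_subset_union_right _ Set.subset_union_right)⟩
  induction ha with
  | of h =>
    rcases h with h | ⟨T, hf, hs, h⟩
    · exact ⟨∅, Set.finite_empty, fun _ hs => hs.elim, .of (.inl h)⟩
    · exact ⟨T, hf, hs, h.mono Set.subset_union_right⟩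
  | const c => exact ⟨∅, Set.finite_empty, fun _ hs => hs.elim, .const c⟩
  | add _ _ iha ihb =>
    obtain ⟨T, hf, hs, h, h'⟩ := pair iha ihb
    exact ⟨T, hf, hs, h.add h'⟩
  | mul _ _ iha ihb =>
    obtain ⟨T, hf, hs, h, h'⟩ := pair iha ihb
    exact ⟨T, hf, hs, h.mul h'⟩
  | inv h0 _ ih =>
    obtain ⟨T, hf, hs, h⟩ := ih
    exact ⟨T, hf, hs, h.inv h0⟩

namespace IsRationallyRecursive

theorem of_ratGen {a : ℕ → K} (ha : RatGen {b | IsRationallyRecursive b} a) :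
    IsRationallyRecursive a := by
  obtain ⟨T, hf, hs, h⟩ := (ha.mono Set.subset_union_right : RatGen (∅ ∪ _) a).exists_finite
  exact ⟨T, hf, hs, by simpa using h⟩

theorem const (c : K) : IsRationallyRecursive (fun _ => c) := of_ratGen (.const c)

/-- The members of a finite system of sequences whose shifts are rational functions of the system
and of sequences already known to be rationally recursive are rationally recursive. -/
theorem of_system {S : Set (ℕ → K)} (hfin : S.Finite)
    (h : ∀ s ∈ S, RatGen (S ∪ {b | IsRationallyRecursive b}) (fun n => s (n + 1)))
    {s : ℕ → K} (hs : s ∈ S) : IsRationallyRecursive s := by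
  choose! T hT hstable hgen using fun s hs => (h s hs).exists_finite
  refine ⟨S ∪ ⋃ s ∈ S, T s, hfin.union (hfin.biUnion hT), ?_, .of (.inl hs)⟩
  rintro t (ht | ht)
  · exact (hgen t ht).mono
      (Set.union_subset_union_right _ (Set.subset_biUnion_of_mem (u := T) ht))
  · obtain ⟨s, hs, ht⟩ := Set.mem_iUnion₂.mp ht
    exact (hstable s hs t ht).mono
      ((Set.subset_biUnion_of_mem (u := T) hs).trans Set.subset_union_right)

/-- A sequence whose shift is rationally recursive is rationally recursive. The orbit of the shift
is delayed by one step, and an extra coordinate with values `1, 0, 0, …` makes the map forget the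
starting point after one step. -/
theorem of_shift {a : ℕ → K} (ha : IsRationallyRecursive (fun n => a (n + 1))) :
    IsRationallyRecursive a := by
  obtain ⟨S, hfin, hstable, ha⟩ := ha
  set t : ℕ → K := fun n => if n = 0 then 1 else 0 with ht
  -- Since `0 - 1 = 0` in `ℕ`, a delayed orbit repeats its first term.
  set delay : (ℕ → K) → ℕ → K := fun s n => s (n - 1) with hdelay
  set S' : Set (ℕ → K) := insert t (delay '' S) with hS'
  have tgen : RatGen S' t := .of (Set.mem_insert _ _)
  have key : ∀ b : ℕ → K, RatGen S (fun n => b (n + 1)) → RatGen S' b := by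
    intro b hb
    have h1 : RatGen S' (fun n => b (n - 1 + 1)) :=
      hb.comp (T := S') (· - 1) fun s hs => .of (.inr ⟨s, hs, rfl⟩)
    convert (tgen.mul (.const (b 0))).add (((RatGen.const 1).sub tgen).mul h1) using 2 with n
    cases n <;> simp [ht]
  refine ⟨S', (hfin.image _).insert _, ?_, key a ha⟩
  rintro s (rfl | ⟨s, hs, rfl⟩)
  · simpa [ht] using RatGen.const (S := S') 0
  · simpa [hdelay] using key s (hstable s hs)

theorem of_shift_add {a : ℕ → K} (k : ℕ) (ha : IsRationallyRecursive (fun n => a (n + k))) :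
    IsRationallyRecursive a := by
  induction k with
  | zero => exact ha
  | succ k ih => exact ih (of_shift (by simpa only [add_assoc, add_comm 1 k] using ha))

/-- A sequence with a recurrence of order `r` that expresses `a (n + r)` rationally through
`a n, …, a (n + r - 1)` and rationally recursive sequences is rationally recursive. -/
theorem of_recurrence {a : ℕ → K} {r : ℕ}
    (h : RatGen ({b | ∃ j < r, b = fun n => a (n + j)} ∪ {b | IsRationallyRecursive b})
      (fun n => a (n + r))) : IsRationallyRecursive a := by
  obtain rfl | hr := Nat.eq_zero_or_pos r
  · exact of_ratGen (by simpa using h)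
  · refine of_system (S := {b | ∃ j < r, b = fun n => a (n + j)}) ?_ ?_ ⟨0, hr, rfl⟩
    · refine ((Set.finite_lt_nat r).image fun j n => a (n + j)).subset ?_
      rintro _ ⟨j, hj, rfl⟩
      exact ⟨j, hj, rfl⟩
    · rintro _ ⟨j, hj, rfl⟩
      rcases Nat.lt_or_ge (j + 1) r with hj' | hj'
      · exact .of (.inl ⟨j + 1, hj', by simp only [add_assoc, add_comm 1 j]⟩)
      · obtain rfl : r = j + 1 := by omega
        simpa only [add_assoc, add_comm 1 j] using h

/-- The sequence of natural numbers in `K`, also when it is periodic in positive characteristic. -/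
theorem natCast : IsRationallyRecursive (fun n => (n : K)) := by
  refine of_system (Set.finite_singleton fun n : ℕ => (n : K)) ?_ rfl
  rintro _ rfl
  simpa only [Nat.cast_add, Nat.cast_one] using (RatGen.of (.inl rfl)).add (.const 1)

end IsRationallyRecursive

theorem _root_.Set.Finite.exists_forall_add_notMem {s : Set ℕ} (hs : s.Finite) :
    ∃ k, ∀ n, n + k ∉ s := by
  obtain ⟨k, hk⟩ := hs.bddAbove
  exact ⟨k + 1, fun n hn => by have := hk hn; omega⟩

/-! ### Finiteness over a class, Somos and elliptic sequences -/

open IsRationallyRecursive in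
theorem IsFiniteOver.isRationallyRecursive {R : (ℕ → K) → Prop}
    (hR : ∀ c, R c → IsRationallyRecursive c) {a : ℕ → K} (ha : IsFiniteOver R a) :
    IsRationallyRecursive a := by
  obtain ⟨r, c, hc, hfin, h⟩ := ha
  -- After a shift by `k` the leading coefficient has no zero left, and the recurrence can be solved
  -- for its last term.
  obtain ⟨k, hk⟩ := hfin.exists_forall_add_notMem
  refine of_shift_add k (of_recurrence (r := r) ?_)
  have hshift : ∀ i, IsRationallyRecursive (fun n => c i (n + k)) := fun i => by
    obtain ⟨S, hf, hs, h⟩ := hR _ (hc i)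
    refine ⟨S, hf, hs, ?_⟩
    clear hk
    induction k with
    | zero => exact h
    | succ k ih => simpa only [add_assoc, add_comm 1 k] using hs.shift ih
  have : (fun n => a (n + r + k)) = fun n =>
      -(∑ i : Fin r, c i.castSucc (n + k) * a (n + i + k)) / c (Fin.last r) (n + k) := by
    funext n
    have hn := h (n + k)
    rw [Fin.sum_univ_castSucc] at hn
    rw [eq_div_iff (hk n), eq_neg_iff_add_eq_zero, ← hn, add_comm, mul_comm]
    simp [add_right_comm]
  rw [this]
  refine (RatGen.sum _ fun i _ => RatGen.mul (.of (.inr (hshift _))) (.of (.inl ⟨i, i.2, rfl⟩))).neg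
    |>.div (.of (.inr (hshift _))) hk

theorem IsDnFinite.isRationallyRecursive (m : ℕ) {a : ℕ → K} (ha : IsDnFinite m a) :
    IsRationallyRecursive a := by
  induction m generalizing a with
  | zero =>
    obtain ⟨p, hp⟩ := ha
    rw [funext hp]
    exact .of_ratGen ((RatGen.of IsRationallyRecursive.natCast).polynomial_eval p)
  | succ m ih => exact IsFiniteOver.isRationallyRecursive (fun _ => ih) ha

theorem IsCnFinite.isRationallyRecursive (m : ℕ) {a : ℕ → K} (ha : IsCnFinite m a) :
    IsRationallyRecursive a := by
  induction m generalizing a with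
  | zero =>
    obtain ⟨c, hc⟩ := ha
    rw [funext hc]
    exact .const c
  | succ m ih => exact IsFiniteOver.isRationallyRecursive (fun _ => ih) ha

open IsRationallyRecursive in
theorem IsSomos.isRationallyRecursive {a : ℕ → K} (ha : IsSomos a) (hfin : {n | a n = 0}.Finite) :
    IsRationallyRecursive a := by
  obtain ⟨k, h⟩ := ha
  obtain ⟨l, hl⟩ := hfin.exists_forall_add_notMem
  have hk : 0 < k := by
    by_contra hk
    obtain rfl : k = 0 := by omega
    exact hl 0 (by simpa using h (0 + l))
  refine of_shift_add l (of_recurrence (r := k) ?_)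
  have : (fun n => a (n + k + l)) = fun n =>
      (∑ i ∈ Finset.Icc 1 (k / 2), a (n + (k - i) + l) * a (n + i + l)) / a (n + 0 + l) := by
    funext n
    have h1 : a (n + 0 + l) ≠ 0 := hl n
    rw [eq_div_iff h1]
    convert h (n + l) using 1
    · congr 2; omega
    · refine Finset.sum_congr rfl fun i hi => ?_
      rw [Finset.mem_Icc] at hi
      congr 2 <;> omega
  rw [this]
  refine RatGen.div (.sum _ fun i hi => ?_) (.of (.inl ⟨0, hk, rfl⟩)) hl
  rw [Finset.mem_Icc] at hi
  exact .mul (.of (.inl ⟨k - i, by omega, rfl⟩)) (.of (.inl ⟨i, by omega, rfl⟩))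

open IsRationallyRecursive in
theorem IsEDS.isRationallyRecursive {W : ℕ → K} (hW : IsEDS W) (hfin : {n | W n = 0}.Finite) :
    IsRationallyRecursive W := by
  obtain ⟨h1, h⟩ := hW
  obtain ⟨l, hl⟩ := hfin.exists_forall_add_notMem
  -- The shift by `l + 1` puts the recurrence, centred at `n + l + 3`, into its range `2 < n`.
  refine of_shift_add (l + 1) (of_recurrence (r := 4) ?_)
  have h0 : ∀ n, W (n + 0 + (l + 1)) * W 1 ^ 2 ≠ 0 := fun n =>
    mul_ne_zero (fun hn => hl (n + 1) (by
      simpa only [add_zero, add_assoc, add_comm 1 l, Set.mem_ofPred_eq] using hn))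
      (pow_ne_zero 2 h1)
  have : (fun n => W (n + 4 + (l + 1))) = fun n =>
      (W (n + 3 + (l + 1)) * W (n + 1 + (l + 1)) * W 2 ^ 2
        - W 3 * W 1 * W (n + 2 + (l + 1)) ^ 2) / (W (n + 0 + (l + 1)) * W 1 ^ 2) := by
    funext n
    rw [eq_div_iff (h0 n), ← mul_assoc]
    have hn := h (n + l + 3) (by omega)
    rw [show n + l + 3 + 2 = n + 4 + (l + 1) by omega,
      show n + l + 3 - 2 = n + 0 + (l + 1) by omega,
      show n + l + 3 + 1 = n + 3 + (l + 1) by omega,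
      show n + l + 3 - 1 = n + 1 + (l + 1) by omega,
      show n + l + 3 = n + 2 + (l + 1) by omega] at hn
    exact hn
  rw [this]
  have gen : ∀ j < 4, RatGen ({b | ∃ j < 4, b = fun n => W (n + j + (l + 1))} ∪
      {b | IsRationallyRecursive b}) (fun n => W (n + j + (l + 1))) :=
    fun j hj => .of (.inl ⟨j, hj, rfl⟩)
  exact ((((gen 3 (by omega)).mul (gen 1 (by omega))).mul (.const _)).sub
    (.mul (.const _) ((gen 2 (by omega)).pow 2))).div ((gen 0 (by omega)).mul (.const _)) h0

end RationalGeneration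

/-! ### Linear recurrences along polynomial and exponential indices -/

section MatrixPowers

variable {K : Type u} [Field K]

/-- A sequence with a linear recurrence is a matrix coefficient of the powers of a matrix, here the
matrix of the shift on windows of consecutive terms. -/
theorem IsLinearRecurrent.exists_matrix {f : ℕ → K} (hf : IsLinearRecurrent f) :
    ∃ (d : ℕ) (M : Matrix (Fin d) (Fin d) K) (u w : Fin d → K),
      ∀ n, f n = ∑ i, ∑ j, u i * (M ^ n) i j * w j := by
  obtain ⟨E, hE⟩ := hf
  have window : ∀ n, (LinearMap.toMatrix' E.tupleSucc ^ n).mulVec (fun i => f i) =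
      fun i : Fin E.order => f (n + i) := by
    intro n
    induction n with
    | zero => simp
    | succ n ih =>
      rw [pow_succ', ← Matrix.mulVec_mulVec, ih, LinearMap.toMatrix'_mulVec]
      funext i
      simp only [LinearRecurrence.tupleSucc, LinearMap.coe_mk, AddHom.coe_mk]
      split_ifs with h
      · congr 1; omega
      · rw [← hE n]; congr 1; omega
  obtain h0 | h0 := Nat.eq_zero_or_pos E.order
  · have : IsEmpty (Fin E.order) := h0 ▸ inferInstance
    refine ⟨0, 0, 0, 0, fun n => ?_⟩
    simpa [h0] using hE n
  · refine ⟨E.order, LinearMap.toMatrix' E.tupleSucc, Pi.single ⟨0, h0⟩ 1, fun i => f i,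
      fun n => ?_⟩
    have := congrFun (window n) ⟨0, h0⟩
    simp only [add_zero, Matrix.mulVec, dotProduct] at this
    rw [Finset.sum_eq_single ⟨0, h0⟩ (fun i _ hi => by simp [hi]) (by simp), ← this]
    simp

theorem IsLinearRecurrent.isRationallyRecursive_comp {f : ℕ → K} (hf : IsLinearRecurrent f)
    {g : ℕ → ℕ}
    (h : ∀ (d : ℕ) (M : Matrix (Fin d) (Fin d) K) (i j : Fin d),
      IsRationallyRecursive (fun n => (M ^ g n) i j)) :
    IsRationallyRecursive (fun n => f (g n)) := by
  obtain ⟨d, M, u, w, hM⟩ := hf.exists_matrix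
  simp only [hM]
  exact .of_ratGen (.sum _ fun i _ => .sum _ fun j _ => ((RatGen.const _).mul (.of (h d M i j))).mul
    (.const _))

/-- The entries of `M ^ d ^ n` are rationally recursive: each matrix is the `d`-th power of the
preceding one. -/
theorem isRationallyRecursive_matrix_pow_pow {r : ℕ} (M : Matrix (Fin r) (Fin r) K) (d : ℕ)
    (i j : Fin r) : IsRationallyRecursive (fun n => (M ^ d ^ n) i j) := by
  refine .of_system (S := Set.range fun (p : Fin r × Fin r) (n : ℕ) => (M ^ d ^ n) p.1 p.2)
    (Set.finite_range _) ?_ ⟨(i, j), rfl⟩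
  rintro _ ⟨p, rfl⟩
  simp only [pow_succ, pow_mul]
  exact .matrix_pow (fun i j => .of (.inl ⟨(i, j), rfl⟩)) d _ _

/-- A rational polynomial has a constant sign far out. -/
theorem _root_.Polynomial.exists_forall_nonneg_or_forall_neg (Q : Polynomial ℚ) :
    ∃ k : ℕ, (∀ n : ℕ, 0 ≤ Q.eval ((n + k : ℕ) : ℚ)) ∨ ∀ n : ℕ, Q.eval ((n + k : ℕ) : ℚ) < 0 := by
  have lift : ∀ {p : ℚ → Prop}, (∀ᶠ x in Filter.atTop, p x) →
      ∃ k : ℕ, ∀ n : ℕ, p ((n + k : ℕ) : ℚ) := by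
    intro p hp
    obtain ⟨k, hk⟩ := Filter.eventually_atTop.mp (tendsto_natCast_atTop_atTop.eventually hp)
    exact ⟨k, fun n => hk _ (by omega)⟩
  rcases le_or_gt Q.degree 0 with h | h
  · rw [Polynomial.eq_C_of_degree_le_zero h]
    refine ⟨0, ?_⟩
    simp only [Polynomial.eval_C]
    exact (le_or_gt 0 (Q.coeff 0)).imp (fun h _ => h) fun h _ => h
  · rcases le_or_gt 0 Q.leadingCoeff with h' | h'
    · obtain ⟨k, hk⟩ := lift ((Q.tendsto_atTop_of_leadingCoeff_nonneg h h').eventually_ge_atTop 0)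
      exact ⟨k, .inl hk⟩
    · obtain ⟨k, hk⟩ :=
        lift ((Q.tendsto_atBot_of_leadingCoeff_nonpos h h'.le).eventually_lt_atBot 0)
      exact ⟨k, .inr hk⟩

/-- For `P` of degree less than `d` with values `p n` in `ℕ`, the entries of `M ^ p n` are rationally
recursive. By induction on `d` this holds for the exponents `p (n + 1) - p n`, and
`M ^ p (n + 1) = M ^ p n * M ^ (p (n + 1) - p n)`. No invertibility of `M` is needed, as `p` is
nondecreasing from some index on. -/
theorem isRationallyRecursive_matrix_pow_polynomial {r : ℕ} (M : Matrix (Fin r) (Fin r) K) (d : ℕ)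
    (P : Polynomial ℚ) (p : ℕ → ℕ) (hd : P.natDegree < d) (hP : ∀ n : ℕ, P.eval (n : ℚ) = p n)
    (i j : Fin r) : IsRationallyRecursive (fun n => (M ^ p n) i j) := by
  induction d generalizing P p i j with
  | zero => omega
  | succ d ih =>
    set Q : Polynomial ℚ := P.comp (Polynomial.X + 1) - P with hQ
    have hQeval : ∀ n : ℕ, Q.eval (n : ℚ) = p (n + 1) - p n := fun n => by
      rw [← hP, ← hP]; simp [hQ]
    obtain ⟨k, hk⟩ := Q.exists_forall_nonneg_or_forall_neg
    simp only [hQeval] at hk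
    -- No sequence of natural numbers is strictly decreasing.
    have hmono : ∀ n : ℕ, p (n + k) ≤ p (n + k + 1) := by
      rcases hk with hk | hk
      · intro n
        have := hk n
        exact_mod_cast sub_nonneg.mp this
      · have hlt : StrictAnti fun n => p (n + k) := strictAnti_nat_of_succ_lt fun n => by
          have := hk n
          rw [add_right_comm]
          exact_mod_cast sub_neg.mp this
        exact (not_strictAnti_of_wellFoundedLT _ hlt).elim
    by_cases hdeg : P.natDegree = 0
    · rw [Polynomial.eq_C_of_natDegree_eq_zero hdeg] at hP
      have hp : ∀ n, p n = p 0 := fun n => by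
        have := (hP n).symm.trans ((by simp : _ = _).trans (hP 0))
        exact_mod_cast this
      simp only [fun n => hp n]
      exact .const _
    refine .of_shift_add k (.of_system
      (S := Set.range fun (q : Fin r × Fin r) (n : ℕ) => (M ^ p (n + k)) q.1 q.2)
      (Set.finite_range _) ?_ ⟨(i, j), rfl⟩)
    rintro _ ⟨⟨i, j⟩, rfl⟩
    have step : (fun n => (M ^ p (n + 1 + k)) i j) = fun n =>
        ∑ l, (M ^ p (n + k)) i l * (M ^ (p (n + k + 1) - p (n + k))) l j := by
      funext n
      rw [← Matrix.mul_apply, ← pow_add, add_right_comm, Nat.add_sub_cancel' (hmono n)]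
    have hQdeg : (Q.comp (Polynomial.X + Polynomial.C (k : ℚ))).natDegree < d := by
      rw [Polynomial.natDegree_comp, Polynomial.natDegree_X_add_C, mul_one]
      have hP0 : P ≠ 0 := fun h => hdeg (by simp [h])
      have : Q.degree < P.degree := by
        rw [hQ, ← Polynomial.C_1, ← Polynomial.taylor_apply]
        refine (Polynomial.degree_sub_lt_left ?_ ?_ ?_).trans_eq ?_ <;> simp [hP0]
      by_cases hQ0 : Q = 0
      · rw [hQ0, Polynomial.natDegree_zero]; omega
      · have := Polynomial.natDegree_lt_natDegree hQ0 this
        omega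
    simp only [step]
    refine .sum _ fun l _ => .mul (.of (.inl ⟨(i, l), rfl⟩)) (.of (.inr ?_))
    refine ih _ _ hQdeg (fun n => ?_) l j
    rw [Nat.cast_sub (hmono n), ← hQeval]
    simp

end MatrixPowers

/-! ### Affine space as a quasi-projective variety -/

section QuasiProjective

attribute [local instance] MvPolynomial.gradedAlgebra

variable (K : Type u) [Field K] {N : ℕ} {ι : Type u} (e : Fin N ≃ ι)

/-- The homomorphism from the degree-zero part of `K[x₀, …, x_N][1 / x₀]` to the polynomial ring
in variables indexed by `ι` that sets `x₀` to `1` and sends the other variables to those of the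
target along `e`. -/
noncomputable def dehomogenize :
    HomogeneousLocalization.Away (MvPolynomial.homogeneousSubmodule (Fin (N + 1)) K)
      (MvPolynomial.X 0) →+* MvPolynomial ι K :=
  (Localization.awayLift (MvPolynomial.aeval (Fin.cons 1 fun i => MvPolynomial.X (e i)) :
      MvPolynomial (Fin (N + 1)) K →ₐ[K] MvPolynomial ι K).toRingHom (MvPolynomial.X 0)
    (by simp)).comp
  (algebraMap _ (Localization.Away (MvPolynomial.X 0 : MvPolynomial (Fin (N + 1)) K)))

theorem X_mem_homogeneousSubmodule_one (i : Fin (N + 1)) :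
    MvPolynomial.X i ∈ MvPolynomial.homogeneousSubmodule (Fin (N + 1)) K 1 :=
  MvPolynomial.isHomogeneous_X K i

theorem dehomogenize_mk (n : ℕ) (x : MvPolynomial (Fin (N + 1)) K)
    (hx : x ∈ MvPolynomial.homogeneousSubmodule (Fin (N + 1)) K (n • 1)) :
    dehomogenize K e
        (HomogeneousLocalization.Away.mk _ (X_mem_homogeneousSubmodule_one K 0) n x hx) =
      MvPolynomial.aeval (Fin.cons 1 fun i => MvPolynomial.X (e i)) x := by
  simp [dehomogenize, Localization.awayLift_mk]

theorem dehomogenize_surjective : Function.Surjective (dehomogenize K e) := by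
  intro p
  induction p using MvPolynomial.induction_on with
  | C c =>
    refine ⟨.mk _ (X_mem_homogeneousSubmodule_one K 0) 0 (MvPolynomial.C c) ?_, ?_⟩
    · simp
    · rw [dehomogenize_mk]; simp [MvPolynomial.algebraMap_eq]
  | add p q hp hq =>
    obtain ⟨p, rfl⟩ := hp
    obtain ⟨q, rfl⟩ := hq
    exact ⟨p + q, map_add _ _ _⟩
  | mul_X p i hp =>
    obtain ⟨p, rfl⟩ := hp
    refine ⟨p * .mk _ (X_mem_homogeneousSubmodule_one K 0) 1
      (MvPolynomial.X (e.symm i).succ) ?_, ?_⟩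
    · rw [map_mul, dehomogenize_mk]; simp
    · exact X_mem_homogeneousSubmodule_one K _

theorem dehomogenize_comp_algebraMap :
    ((dehomogenize K e).comp (HomogeneousLocalization.fromZeroRingHom _ _)).comp
      (algebraMap K (MvPolynomial.homogeneousSubmodule (Fin (N + 1)) K 0)) = MvPolynomial.C := by
  ext1 c
  have h : HomogeneousLocalization.fromZeroRingHom _ (Submonoid.powers (MvPolynomial.X 0))
      (algebraMap K (MvPolynomial.homogeneousSubmodule (Fin (N + 1)) K 0) c) =
      HomogeneousLocalization.Away.mk _ (X_mem_homogeneousSubmodule_one K 0) 0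
        (MvPolynomial.C c) (by simp) := by
    ext1
    simp only [HomogeneousLocalization.Away.val_mk, pow_zero]
    rfl
  rw [RingHom.comp_apply, RingHom.comp_apply, h, dehomogenize_mk]
  simp [MvPolynomial.algebraMap_eq]

/-- The immersion of affine space into projective space as the chart where `x₀` does not vanish,
presented as a closed immersion into the spectrum of the degree-zero part of
`K[x₀, …, x_N][1 / x₀]`, followed by the inclusion of that chart. -/
noncomputable def toProjSpace : 𝔸(ι; Spec (.of K)) ⟶
    Proj (MvPolynomial.homogeneousSubmodule (Fin (N + 1)) K) :=
  (AffineSpace.SpecIso ι (.of K)).hom ≫ Spec.map (CommRingCat.ofHom (dehomogenize K e)) ≫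
    Proj.awayι (MvPolynomial.homogeneousSubmodule (Fin (N + 1)) K) (MvPolynomial.X 0)
      (X_mem_homogeneousSubmodule_one K 0) one_pos

theorem isImmersion_toProjSpace : IsImmersion (toProjSpace K e) := by
  have : IsClosedImmersion (Spec.map (CommRingCat.ofHom (dehomogenize K e))) :=
    IsClosedImmersion.spec_of_surjective _ (dehomogenize_surjective K e)
  unfold toProjSpace
  infer_instance

theorem toProjSpace_toBase :
    toProjSpace K e ≫ Proj.toSpecZero (MvPolynomial.homogeneousSubmodule (Fin (N + 1)) K) ≫
      Spec.map (CommRingCat.ofHom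
        (algebraMap K (MvPolynomial.homogeneousSubmodule (Fin (N + 1)) K 0))) =
      𝔸(ι; Spec (.of K)) ↘ Spec (.of K) := by
  rw [toProjSpace, Category.assoc, Category.assoc,
    Proj.awayι_toSpecZero_assoc, ← Spec.map_comp, ← Spec.map_comp, ← Iso.eq_inv_comp,
    AffineSpace.SpecIso_inv_over, ← CommRingCat.ofHom_comp, ← CommRingCat.ofHom_comp]
  congr 2
  exact dehomogenize_comp_algebraMap K e

theorem isQuasiProjectiveVariety_affineSpace (ι : Type u) [Finite ι] :
    IsQuasiProjectiveVariety K 𝔸(ι; Spec (.of K)) where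
  isIntegral := inferInstance
  exists_immersion :=
    ⟨Nat.card ι, toProjSpace K (Finite.equivFin ι).symm, isImmersion_toProjSpace K _,
      toProjSpace_toBase K _⟩

end QuasiProjective

/-! ### Rational maps of affine spaces from rational functions -/

section RationalMaps

variable {K : Type u} [Field K] {ι κ : Type u}

/-- The `K`-point of affine space with coordinates `v`. -/
noncomputable def affinePoint (v : ι → K) : Spec (.of K) ⟶ 𝔸(ι; Spec (.of K)) :=
  AffineSpace.homOfVector (𝟙 _) (fun i => (Scheme.ΓSpecIso (.of K)).inv.hom (v i))

/-- A polynomial as a global function on affine space. -/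
noncomputable def polynomialSection : MvPolynomial ι K →+* Γ(𝔸(ι; Spec (.of K)), ⊤) :=
  MvPolynomial.eval₂Hom
    ((𝔸(ι; Spec (.of K)) ↘ Spec (.of K)).appTop.hom.comp (Scheme.ΓSpecIso (.of K)).inv.hom)
    (AffineSpace.coord _)

theorem affinePoint_appTop_polynomialSection (v : ι → K) (p : MvPolynomial ι K) :
    (affinePoint v).appTop.hom (polynomialSection p) =
      (Scheme.ΓSpecIso (.of K)).inv.hom (MvPolynomial.eval v p) := by
  suffices (affinePoint v).appTop.hom.comp polynomialSection =
      (Scheme.ΓSpecIso (.of K)).inv.hom.comp (MvPolynomial.eval v) from RingHom.congr_fun this p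
  apply MvPolynomial.ringHom_ext
  · intro c
    have : (affinePoint v ≫ 𝔸(ι; Spec (.of K)) ↘ Spec (.of K)).appTop = 𝟙 _ := by
      rw [affinePoint, AffineSpace.homOfVector_over, Scheme.Hom.id_appTop]
    have h := congr($(this).hom ((Scheme.ΓSpecIso (.of K)).inv.hom c))
    rw [Scheme.Hom.comp_appTop] at h
    simpa [polynomialSection] using h
  · intro i
    simp only [polynomialSection, RingHom.comp_apply, MvPolynomial.eval₂Hom_X',
      MvPolynomial.eval_X]
    exact AffineSpace.homOfVector_appTop_coord _ _ i

theorem range_affinePoint_subset {v : ι → K} {q : MvPolynomial ι K}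
    (hq : MvPolynomial.eval v q ≠ 0) :
    Set.range (affinePoint v) ⊆
      ((𝔸(ι; Spec (.of K))).basicOpen (polynomialSection q) : Set 𝔸(ι; Spec (.of K))) := by
  rintro _ ⟨x, rfl⟩
  have h : affinePoint v ⁻¹ᵁ (𝔸(ι; Spec (.of K))).basicOpen (polynomialSection q) = ⊤ := by
    rw [Scheme.preimage_basicOpen_top]
    apply Scheme.basicOpen_of_isUnit
    erw [affinePoint_appTop_polynomialSection]
    exact (hq.isUnit).map _
  exact (h.ge trivial : x ∈ _)

/-- Rational functions with a common denominator `q` give a rational map between affine spaces,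
defined at each point where `q` does not vanish. -/
theorem exists_rationalMap (P : κ → MvPolynomial ι K) (q : MvPolynomial ι K)
    (hq : ∃ v, MvPolynomial.eval v q ≠ 0) :
    ∃ g : 𝔸(ι; Spec (.of K)) ⤏ 𝔸(κ; Spec (.of K)), g.IsOver (Spec (.of K)) ∧
      ∀ v, MvPolynomial.eval v q ≠ 0 → MapsPoint g (affinePoint v)
        (affinePoint fun k => MvPolynomial.eval v (P k) / MvPolynomial.eval v q) := by
  set U := (𝔸(ι; Spec (.of K))).basicOpen (polynomialSection q)
  obtain ⟨v₀, hv₀⟩ := hq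
  have hdense : Dense (U : Set 𝔸(ι; Spec (.of K))) :=
    U.2.dense ⟨_, range_affinePoint_subset hv₀ ⟨Classical.arbitrary _, rfl⟩⟩
  have hunit : IsUnit (U.ι.appTop.hom (polynomialSection q)) := by
    have h := ((𝔸(ι; Spec (.of K))).toRingedSpace.isUnit_res_basicOpen
      (polynomialSection q)).map ((𝔸(ι; Spec (.of K))).presheaf.map
        (homOfLE (U.ι_image_le ⊤)).op).hom
    erw [← CommRingCat.comp_apply, ← Functor.map_comp] at h
    exact h
  obtain ⟨r, hr⟩ := hunit.exists_right_inv
  let h : (𝔸(ι; Spec (.of K))).PartialMap 𝔸(κ; Spec (.of K)) :=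
    { domain := U
      dense_domain := hdense
      hom := AffineSpace.homOfVector (U.ι ≫ 𝔸(ι; Spec (.of K)) ↘ Spec (.of K))
        fun k => U.ι.appTop.hom (polynomialSection (P k)) * r }
  have hover : h.IsOver (Spec (.of K)) := ⟨by simp [h]⟩
  refine ⟨h.toRationalMap, inferInstance, fun v hv => ⟨h, rfl, ?_⟩⟩
  refine ⟨IsOpenImmersion.lift U.ι (affinePoint v) ?_, IsOpenImmersion.lift_fac _ _ _, ?_⟩
  · simpa using range_affinePoint_subset hv
  set p' := IsOpenImmersion.lift U.ι (affinePoint v) _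
  have fac : p' ≫ U.ι = affinePoint v := IsOpenImmersion.lift_fac _ _ _
  have pull : ∀ p, p'.appTop.hom (U.ι.appTop.hom (polynomialSection p)) =
      (Scheme.ΓSpecIso (.of K)).inv.hom (MvPolynomial.eval v p) := by
    intro p
    rw [← affinePoint_appTop_polynomialSection, ← fac, Scheme.Hom.comp_appTop]
    rfl
  change p' ≫ AffineSpace.homOfVector _ _ = _
  rw [AffineSpace.comp_homOfVector, affinePoint, reassoc_of% fac]
  congr 1
  · exact AffineSpace.homOfVector_over _ _
  · funext k
    have h1 := congr(p'.appTop.hom $hr)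
    rw [map_mul, pull, map_one] at h1
    simp only [Function.comp_apply]
    erw [map_mul, pull]
    rw [div_eq_mul_inv, map_mul]
    congr 1
    rw [← one_mul ((Scheme.ΓSpecIso (.of K)).inv.hom _), ← h1, mul_right_comm, ← map_mul]
    simp [hv]

/-- The orbit of the members of a finite shift stable set `S` lies on the affine space with
coordinates indexed by `S`; the rational functions giving the shifts, put over a common denominator,
are the components of the rational self-map. -/
theorem IsRationallyRecursive.isDynamicalSequence {a : ℕ → K} (ha : IsRationallyRecursive a) :
    IsDynamicalSequence a := by
  classical
  obtain ⟨S, hfin, hstable, ha⟩ := ha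
  have : Fintype S := hfin.fintype
  set v : S → ℕ → K := fun s => s
  have hrange : Set.range v = S := Subtype.range_coe
  have hgen : ∀ s : S, RatGen (Set.range v) (fun n => v s (n + 1)) := fun s => by
    rw [hrange]
    exact hstable s s.2
  choose p q hpq using fun s => (hgen s).exists_eval_div_eval
  rw [← hrange] at ha
  obtain ⟨pa, qa, ha⟩ := ha.exists_eval_div_eval
  have hq : ∀ n, MvPolynomial.eval (fun i => v i n) (∏ s, q s) ≠ 0 := fun n => by
    rw [map_prod]
    exact Finset.prod_ne_zero_iff.mpr fun s _ => (hpq s n).1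
  obtain ⟨φ, hφ, hφv⟩ := exists_rationalMap (fun s => p s * ∏ t ∈ Finset.univ.erase s, q t)
    (∏ s, q s) ⟨_, hq 0⟩
  obtain ⟨f, hf, hfv⟩ := exists_rationalMap (fun _ : PUnit.{u + 1} => pa) qa ⟨_, (ha 0).1⟩
  -- `linePoint` is by definition the point of the affine space with index type `PUnit`.
  refine ⟨𝔸(S; Spec (.of K)), inferInstance, φ, f, fun n => affinePoint fun s => v s n,
    isQuasiProjectiveVariety_affineSpace K S, hφ, hf, AffineSpace.homOfVector_over _ _,
    fun n => ?_, fun n => ?_⟩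
  · convert hφv _ (hq n) using 2
    funext s
    rw [(hpq s n).2, ← Finset.mul_prod_erase _ q (Finset.mem_univ s), map_mul, map_mul,
      mul_div_mul_right]
    intro h0
    refine hq n ?_
    rw [← Finset.mul_prod_erase _ q (Finset.mem_univ s), map_mul, h0, mul_zero]
  · convert hfv _ (ha n).1 using 1
    rw [linePoint, affinePoint, (ha n).2]

end RationalMaps

end DynSeq

theorem theorem3p1 {K : Type u} [Field K] [IsAlgClosed K] :
    (∀ m : ℕ, 1 ≤ m → ∀ a : ℕ → K, DynSeq.IsDnFinite m a → DynSeq.IsDynamicalSequence a) ∧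
    (∀ m : ℕ, 1 ≤ m → ∀ a : ℕ → K, DynSeq.IsCnFinite m a → DynSeq.IsDynamicalSequence a) ∧
    (∀ a : ℕ → K, DynSeq.IsSomos a → {n | a n = 0}.Finite → DynSeq.IsDynamicalSequence a) ∧
    (∀ a : ℕ → K, DynSeq.IsEDS a → {n | a n = 0}.Finite → DynSeq.IsDynamicalSequence a) ∧
    (∀ f : ℕ → K, DynSeq.IsLinearRecurrent f →
      ∀ (P : Polynomial ℚ) (p : ℕ → ℕ), (∀ n : ℕ, P.eval (n : ℚ) = (p n : ℚ)) →
        DynSeq.IsDynamicalSequence (fun n => f (p n))) ∧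
    (∀ f : ℕ → K, DynSeq.IsLinearRecurrent f →
      ∀ d : ℕ, DynSeq.IsDynamicalSequence (fun n => f (d ^ n))) :=
  ⟨fun m _ _ h => (h.isRationallyRecursive m).isDynamicalSequence,
    fun m _ _ h => (h.isRationallyRecursive m).isDynamicalSequence,
    fun _ h h0 => (h.isRationallyRecursive h0).isDynamicalSequence,
    fun _ h h0 => (h.isRationallyRecursive h0).isDynamicalSequence,
    fun _ hf P p hP => (hf.isRationallyRecursive_comp fun _ M i j =>
      DynSeq.isRationallyRecursive_matrix_pow_polynomial M _ P p (Nat.lt_succ_self _) hP i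
        j).isDynamicalSequence,
    fun _ hf d => (hf.isRationallyRecursive_comp fun _ M i j =>
      DynSeq.isRationallyRecursive_matrix_pow_pow M d i j).isDynamicalSequence⟩
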